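/- Let $0<q<1$ and let $(a;q)_m=\prod_{j=0}^{m-1}(1-aq^j)$. For integers $0\le n\le N$ and real $\alpha,\beta$ for which no denominator vanishes, the monic $q$-Hahn polynomial of degree $n$ in the variable $\bar x$ is $$\tilde Q_n(\bar x;\alpha,\beta,N|q)=\frac{(\alpha q;q)_n\,(q^{-N};q)_n}{(\alpha\beta q^{n+1};q)_n}\sum_{m=0}^{n}\frac{(q^{-n};q)_m(\alpha\beta q^{n+1};q)_m(\bar x;q)_m}{(\alpha q;q)_m(q^{-N};q)_m}\,\frac{q^m}{(q;q)_m}.$$ **Theorem 2.7.** Let $N\ge 1$ and $n\in\{1,\dots,N\}$ be integers and let $\alpha,\beta\in\mathbb R$ satisfy $0<\alpha q<1$ and $0<\beta q<1$; if $n=1$, assume moreover that $\alpha\beta q<1$. Then $\tilde Q_n(\bar x;\alpha,\beta,N|q)$ and $\tilde Q_{n-1}(\bar x;\alpha,\beta,N|q)$ have degrees $n$ and $n-1$ and only real simple zeros, denoted by $x_{n,1}<\dots<x_{n,n}$ and $x_{n-1,1}<\dots<x_{n-1,n-1}$ respectively, and the following hold. (i) If $\alpha>1$, then $\tilde Q_n(\bar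 x;\frac{\alpha}{q},\beta,N|q)$ has degree $n$ and only real simple zeros $y_{n,1}<\dots<y_{n,n}$, and $$y_{n,1}<1<x_{n,1}<x_{n-1,1}<y_{n,2}<x_{n,2}<\cdots<x_{n-1,n-1}<y_{n,n}<x_{n,n}<q^{-N}.$$ (ii) If $\beta>1$, then $\tilde Q_n(\bar x;\alpha,\frac{\beta}{q},N|q)$ has degree $n$ and only real simple zeros $z_{n,1}<\dots<z_{n,n}$, and $$1<x_{n,1}<z_{n,1}<x_{n-1,1}<x_{n,2}<z_{n,2}<\cdots<x_{n-1,n-1}<x_{n,n}<q^{-N}<z_{n,n}.$$ (For $n=1$ the chains read $y_{1,1}<1<x_{1,1}<q^{-N}$ and $1<x_{1,1}<q^{-N}<z_{1,1}$.) -/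

import Mathlib

open Polynomial

/-- The `q`-Pochhammer symbol `(a; q)_m = ∏_{j < m} (1 - a q^j)`, over any commutative ring
(used both for real numbers and for real polynomials in the variable). -/
def qPoch {R : Type*} [CommRing R] (a q : R) (m : ℕ) : R :=
  ∏ j ∈ Finset.range m, (1 - a * q ^ j)

/-- The basic hypergeometric series `_rφ_s(a; b; q, z)`, with the lists `a` (of length `r`) and
`b` (of length `s`) as upper and lower parameters. -/
noncomputable def basicHypergeometric (a b : List ℝ) (q z : ℝ) : ℝ :=
  ∑' m : ℕ, (a.map fun c => qPoch c q m).prod / (b.map fun c => qPoch c q m).prod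
    * ((-1) ^ m * q ^ m.choose 2) ^ (1 + (b.length : ℤ) - (a.length : ℤ))
    * (z ^ m / qPoch q q m)

/-- The monic `q`-Hahn polynomial in the variable `X`:
`(αq; q)_n (q^{-N}; q)_n / (αβq^{n+1}; q)_n * _3φ_2(q^{-n}, αβq^{n+1}, X; αq, q^{-N}; q, q)`,
where the series terminates after the index `m = n`. -/
noncomputable def qHahn (n : ℕ) (α β : ℝ) (N : ℕ) (q : ℝ) : ℝ[X] :=
  C (qPoch (α * q) q n * qPoch (q ^ (-(N : ℤ))) q n / qPoch (α * β * q ^ (n + 1)) q n) *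
    ∑ m ∈ Finset.range (n + 1),
      C (qPoch (q ^ (-(n : ℤ))) q m * qPoch (α * β * q ^ (n + 1)) q m
          / (qPoch (α * q) q m * qPoch (q ^ (-(N : ℤ))) q m) * (q ^ m / qPoch q q m)) *
        qPoch X (C q) m

/-- The values of `qHahn` are given by the defining `_3φ_2` series. -/
theorem qHahn_eval (n : ℕ) (α β : ℝ) (N : ℕ) (q : ℝ) (hq : 0 < q) (x : ℝ) :
    (qHahn n α β N q).eval x =
      qPoch (α * q) q n * qPoch (q ^ (-(N : ℤ))) q n / qPoch (α * β * q ^ (n + 1)) q n *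
        basicHypergeometric [q ^ (-(n : ℤ)), α * β * q ^ (n + 1), x]
          [α * q, q ^ (-(N : ℤ))] q q := by
  unfold qHahn basicHypergeometric
  rw [eval_mul, eval_C, eval_finsetSum]
  congr 1
  rw [tsum_eq_sum (s := Finset.range (n + 1))]
  · refine Finset.sum_congr rfl fun m _ => ?_
    have h : (qPoch (X : ℝ[X]) (C q) m).eval x = qPoch x q m := by
      simp [qPoch, eval_prod]
    rw [eval_mul, eval_C, h]
    simp
    ring
  · intro m hm
    have hm' : n < m := by simpa using hm
    have h : qPoch (q ^ (-(n : ℤ))) q m = 0 := by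
      refine Finset.prod_eq_zero (Finset.mem_range.mpr hm') ?_
      rw [zpow_neg, zpow_natCast, inv_mul_cancel₀ (pow_ne_zero _ hq.ne'), sub_self]
    simp only [List.map_cons, List.prod_cons, h, zero_mul, zero_div]

/-- `x 1 < x 2 < ⋯ < x n` is the list of all zeros of the real polynomial `p` of degree `n`:
all its zeros are real and simple. -/
def IsOrderedZeros (p : ℝ[X]) (n : ℕ) (x : ℕ → ℝ) : Prop :=
  p.degree = n ∧ StrictMonoOn x (Set.Icc 1 n) ∧ p.roots = (Finset.Icc 1 n).val.map x

/-! Write `Q_n(a, b)` for the monic polynomial of degree `n` with parameters `a`, `b`. Comparing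
coefficients in the basis `(X; q)_m` gives three relations: `Q_{n+1}(a, b) = Q_{n+1}(aq, b) + c
Q_n(aq, b)`, `Q_{n+1}(a, b) = Q_{n+1}(a, bq) + d Q_n(a, bq)`, and the Christoffel formula `(X - aq)
Q_n(aq, b) = Q_{n+1}(a, b) + e Q_n(a, b)`.

No orthogonality is used. Eliminating `Q_n(aq, b)` and `Q_{n+1}(aq, b)` between the first and third
relations yields a three-term recurrence with `B = c e > 0`. Together with the signs at `1` and
`q^{-N}`, it gives simple interlacing zeros `x_j`, `w_j` in `(1, q^{-N})`
(`exists_interlacedZeros_qHahn`).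

The shifted polynomials are then `p = P + cQ` with `c > 0` and `p = P + dQ` with `d < 0`, where `P`,
`Q` are the unshifted ones. The sign of `p` is known at each `x_j` (from `Q`) and each `w_j` (from
`P`), which locates all zeros but one. The last zero lies beyond an endpoint: `1 - α < 0` reverses
the sign of the value at `1`, and `β > 1` makes the value at `q^{-N}` negative (`exists_zeros_add`,
`exists_zeros_sub`). -/

/-! ### Pochhammer symbols and the expansion in the basis `(X; q)_m`. -/

theorem qPoch_zero {R : Type*} [CommRing R] (a q : R) : qPoch a q 0 = 1 := by simp [qPoch]

theorem qPoch_succ {R : Type*} [CommRing R] (a q : R) (m : ℕ) :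
    qPoch a q (m + 1) = qPoch a q m * (1 - a * q ^ m) := by
  simp [qPoch, Finset.prod_range_succ]

theorem qPoch_succ' {R : Type*} [CommRing R] (a q : R) (m : ℕ) :
    qPoch a q (m + 1) = (1 - a) * qPoch (a * q) q m := by
  simp only [qPoch, Finset.prod_range_succ', pow_zero, mul_one, mul_comm (1 - a)]
  congr 1
  exact Finset.prod_congr rfl fun j _ => by ring

theorem one_sub_mul_qPoch_mul {R : Type*} [CommRing R] (a q : R) (m : ℕ) :
    (1 - a) * qPoch (a * q) q m = qPoch a q m * (1 - a * q ^ m) := by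
  rw [← qPoch_succ', qPoch_succ]

theorem qPoch_mul_eq_div {a q : ℝ} (h : 1 - a ≠ 0) (m : ℕ) :
    qPoch (a * q) q m = qPoch a q m * (1 - a * q ^ m) / (1 - a) := by
  rw [← one_sub_mul_qPoch_mul]; field_simp

theorem qPoch_ne_zero {a q : ℝ} {m : ℕ} (h : ∀ j < m, 1 - a * q ^ j ≠ 0) : qPoch a q m ≠ 0 :=
  Finset.prod_ne_zero_iff.mpr fun j hj => h j (Finset.mem_range.mp hj)

theorem qPoch_pos {a q : ℝ} {m : ℕ} (h : ∀ j < m, 0 < 1 - a * q ^ j) : 0 < qPoch a q m :=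
  Finset.prod_pos fun j hj => h j (Finset.mem_range.mp hj)

/-- Since `(q^{-N}; q)_m` has `m` negative factors for `m ≤ N`, its sign is `(-1)^m`. -/
theorem neg_one_pow_mul_qPoch_pos {a q : ℝ} {m : ℕ} (h : ∀ j < m, 1 - a * q ^ j < 0) :
    0 < (-1) ^ m * qPoch a q m := by
  induction m with
  | zero => simp [qPoch_zero]
  | succ m ih =>
    have h1 := ih fun j hj => h j (hj.trans m.lt_succ_self)
    have h2 := h m m.lt_succ_self
    rw [qPoch_succ, pow_succ]
    nlinarith

theorem qPoch_inv_pow_eq_zero {q : ℝ} (hq : q ≠ 0) {n m : ℕ} (h : n < m) :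
    qPoch ((q ^ n)⁻¹) q m = 0 := by
  refine Finset.prod_eq_zero (Finset.mem_range.mpr h) ?_
  rw [inv_mul_cancel₀ (pow_ne_zero _ hq), sub_self]

theorem one_sub_inv_pow_mul_neg {q : ℝ} (hq0 : 0 < q) (hq1 : q < 1) {N j : ℕ} (h : j < N) :
    1 - (q ^ N)⁻¹ * q ^ j < 0 := by
  have h1 : q ^ N < q ^ j := pow_lt_pow_right_of_lt_one₀ hq0 hq1 h
  have h2 : 0 < q ^ N := pow_pos hq0 N
  have h3 : 1 < (q ^ N)⁻¹ * q ^ j := by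
    rw [inv_mul_eq_div, lt_div_iff₀ h2]; linarith
  linarith

/-- The coefficient of `(X; q)_m` in the monic `q`-Hahn polynomial with `s = αβ`. -/
noncomputable def qHahnCoeff (n : ℕ) (a s : ℝ) (N : ℕ) (q : ℝ) (m : ℕ) : ℝ :=
  qPoch (a * q) q n * qPoch ((q ^ N)⁻¹) q n / qPoch (s * q ^ (n + 1)) q n *
    (qPoch ((q ^ n)⁻¹) q m * qPoch (s * q ^ (n + 1)) q m
      / (qPoch (a * q) q m * qPoch ((q ^ N)⁻¹) q m) * (q ^ m / qPoch q q m))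

theorem qHahnCoeff_eq_zero {n : ℕ} (a s : ℝ) (N : ℕ) {q : ℝ} (hq : q ≠ 0) {m : ℕ} (h : n < m) :
    qHahnCoeff n a s N q m = 0 := by
  simp [qHahnCoeff, qPoch_inv_pow_eq_zero hq h]

theorem qHahn_eq_sum (n : ℕ) (a b : ℝ) (N : ℕ) {q : ℝ} (hq : q ≠ 0) {M : ℕ} (h : n < M) :
    qHahn n a b N q =
      ∑ m ∈ Finset.range M, C (qHahnCoeff n a (a * b) N q m) * qPoch X (C q) m := by
  have h1 : qHahn n a b N q =
      ∑ m ∈ Finset.range (n + 1), C (qHahnCoeff n a (a * b) N q m) * qPoch X (C q) m := by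
    unfold qHahn qHahnCoeff
    rw [Finset.mul_sum]
    refine Finset.sum_congr rfl fun m _ => ?_
    simp only [zpow_neg, zpow_natCast]
    rw [← mul_assoc, ← C_mul]
  rw [h1]
  refine Finset.sum_subset (Finset.range_subset_range.mpr h) fun m _ hm => ?_
  rw [qHahnCoeff_eq_zero _ _ _ hq (by simpa using hm), C_0, zero_mul]

/-! ### Coefficient identities. -/

section Connection

variable {q : ℝ} (hq0 : 0 < q) (hq1 : q < 1) {N n : ℕ} {a s : ℝ}

theorem one_sub_pow_succ_pos {q : ℝ} (hq0 : 0 < q) (hq1 : q < 1) (j : ℕ) :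
    0 < 1 - q * q ^ j := by
  have := pow_lt_one₀ hq0.le hq1 (Nat.succ_ne_zero j)
  rw [pow_succ'] at this
  linarith

include hq0 hq1

theorem qHahnCoeff_connection_left (hnN : n + 1 ≤ N)
    (ha : ∀ j, 1 - a * q * q ^ j ≠ 0) (hs : ∀ j, 1 - s * q ^ (n + 2) * q ^ j ≠ 0)
    {m : ℕ} (hm : m ≤ n + 1) (c : ℝ)
    (hc : c * ((1 - s * q ^ (n + 2) * q ^ n) * (1 - s * q ^ (n + 2) * q ^ (n + 1))) =
      -(1 - (q ^ N)⁻¹ * q ^ n) * (1 - q ^ (n + 1)) * (a * q - s * q ^ (n + 2))) :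
    qHahnCoeff (n + 1) a s N q m =
      qHahnCoeff (n + 1) (a * q) (s * q) N q m + c * qHahnCoeff n (a * q) (s * q) N q m := by
  have hqm : qPoch q q m ≠ 0 := qPoch_ne_zero fun j _ => (one_sub_pow_succ_pos hq0 hq1 j).ne'
  have hN : qPoch ((q ^ N)⁻¹) q m ≠ 0 :=
    qPoch_ne_zero fun j hj => (one_sub_inv_pow_mul_neg hq0 hq1 (by omega)).ne
  have ham : qPoch (a * q) q m ≠ 0 := qPoch_ne_zero fun j _ => ha j
  have hsn : qPoch (s * q ^ (n + 2)) q n ≠ 0 := qPoch_ne_zero fun j _ => hs j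
  have ha0 : 1 - a * q ≠ 0 := by simpa using ha 0
  have hs0 : 1 - s * q ^ (n + 2) ≠ 0 := by simpa using hs 0
  have hsn0 := hs n
  have hsn1 := hs (n + 1)
  have ham1 := ha m
  have hqn : (1 - (q ^ (n + 1))⁻¹) ≠ 0 := by
    have := one_sub_inv_pow_mul_neg hq0 hq1 (Nat.succ_pos n)
    rw [pow_zero, mul_one] at this
    exact this.ne
  have hqn' : q ^ (n + 1) ≠ 0 := (pow_pos hq0 _).ne'
  have hqq : (q ^ n)⁻¹ = (q ^ (n + 1))⁻¹ * q := by
    rw [pow_succ, mul_inv, mul_assoc, inv_mul_cancel₀ hq0.ne', mul_one]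
  have e1 : s * q * q ^ (n + 1 + 1) = s * q ^ (n + 2) * q := by ring
  have e2 : s * q * q ^ (n + 1) = s * q ^ (n + 2) := by ring
  have hc' : c = -(1 - (q ^ N)⁻¹ * q ^ n) * (1 - q ^ (n + 1)) * (a * q - s * q ^ (n + 2)) /
      ((1 - s * q ^ (n + 2) * q ^ n) * (1 - s * q ^ (n + 2) * q ^ (n + 1))) := by
    rw [← hc]; field_simp
  unfold qHahnCoeff
  -- All Pochhammer symbols are reduced to common ones, which cancel. What remains is a rational
  -- identity in `q ^ n`, `q ^ m`, `(q ^ N)⁻¹`, `q`, `a`, `s`.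
  rw [e1, e2, show s * q ^ (n + 1 + 1) = s * q ^ (n + 2) from rfl, hqq,
    qPoch_mul_eq_div hs0, qPoch_mul_eq_div hs0, qPoch_mul_eq_div hqn,
    qPoch_mul_eq_div (m := m) ha0, qPoch_succ' (a * q) q n, qPoch_succ (a * q * q) q n,
    qPoch_succ (s * q ^ (n + 2)) q n, qPoch_succ ((q ^ N)⁻¹) q n, hc']
  generalize qPoch (a * q * q) q n = A0
  generalize qPoch ((q ^ (n + 1))⁻¹) q m = U
  generalize qPoch ((q ^ N)⁻¹) q n = R0
  generalize qPoch (s * q ^ (n + 2)) q m = S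
  generalize qPoch (s * q ^ (n + 2)) q n = S0 at *
  generalize qPoch (a * q) q m = A at *
  generalize qPoch q q m = Z at *
  generalize qPoch ((q ^ N)⁻¹) q m = RN at *
  generalize (q ^ N)⁻¹ = r at *
  simp only [pow_succ] at *
  generalize q ^ n = x at *
  generalize q ^ m = y at *
  have hx : x ≠ 0 := left_ne_zero_of_mul hqn'
  have hq := hq0.ne'
  have hqn2 : x * q - 1 ≠ 0 := by
    intro h; apply hqn; rw [sub_eq_zero.mp h]; simp
  have f1 : 1 - (x * q)⁻¹ = (x * q - 1) / (x * q) := by field_simp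
  have f2 : 1 - (x * q)⁻¹ * y = (x * q - y) / (x * q) := by field_simp
  rw [f1, f2]
  clear f1 f2 hc' hc hqq e1 e2 hqn hs ha hqn'
  -- The denominators are kept as atoms while fractions are cleared, and expanded only for the final
  -- `ring`.
  generalize h1 : 1 - s * (x * q * q) = D1 at *
  generalize h2 : 1 - s * (x * q * q) * x = D2 at *
  generalize h3 : 1 - s * (x * q * q) * (x * q) = D3 at *
  generalize h4 : 1 - a * q = D4 at *
  generalize h5 : 1 - a * q * y = D5 at *
  generalize h6 : x * q - 1 = D6 at *
  field_simp
  subst h1 h2 h3 h4 h5 h6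
  ring

end Connection

theorem qHahnCoeff_christoffel_zero {q : ℝ} {N n : ℕ} {a s : ℝ}
    (ha : ∀ j, 1 - a * q * q ^ j ≠ 0) (hs : ∀ j, 1 - s * q ^ (n + 1) * q ^ j ≠ 0) (e : ℝ)
    (he : e * ((1 - s * q ^ (n + 1) * q ^ n) * (1 - s * q ^ (n + 1) * q ^ (n + 1))) =
      (1 - a * q * q ^ n) * (1 - s * q ^ (n + 1)) *
        ((q ^ N)⁻¹ * q ^ n - s * q ^ (n + 1) * q ^ (n + 1))) :
    (1 - a * q) * qHahnCoeff n (a * q) (s * q) N q 0 =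
      qHahnCoeff (n + 1) a s N q 0 + e * qHahnCoeff n a s N q 0 := by
  have hsn : qPoch (s * q ^ (n + 1)) q n ≠ 0 := qPoch_ne_zero fun j _ => hs j
  have ha0 : 1 - a * q ≠ 0 := by simpa using ha 0
  have hs0 : 1 - s * q ^ (n + 1) ≠ 0 := by simpa using hs 0
  have hsn0 := hs n
  have hsn1 := hs (n + 1)
  have e1 : s * q * q ^ (n + 1) = s * q ^ (n + 1) * q := by ring
  have e2 : s * q ^ (n + 1 + 1) = s * q ^ (n + 1) * q := by ring
  have he' : e = (1 - a * q * q ^ n) * (1 - s * q ^ (n + 1)) *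
        ((q ^ N)⁻¹ * q ^ n - s * q ^ (n + 1) * q ^ (n + 1)) /
      ((1 - s * q ^ (n + 1) * q ^ n) * (1 - s * q ^ (n + 1) * q ^ (n + 1))) :=
    eq_div_of_mul_eq (mul_ne_zero hsn0 hsn1) he
  unfold qHahnCoeff
  simp only [qPoch_zero, pow_zero, mul_one, div_one]
  rw [e1, e2, qPoch_mul_eq_div hs0, qPoch_mul_eq_div hs0,
    qPoch_mul_eq_div ha0,
    qPoch_succ (a * q) q n,
    qPoch_succ (s * q ^ (n + 1)) q n,
    qPoch_succ ((q ^ N)⁻¹) q n, he']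
  clear he' he e1 e2 hs ha
  generalize qPoch (a * q) q n = A0
  generalize qPoch ((q ^ N)⁻¹) q n = R0
  generalize qPoch (s * q ^ (n + 1)) q n = S0 at *
  generalize (q ^ N)⁻¹ = r at *
  simp only [pow_succ] at *
  generalize q ^ n = x at *
  generalize h1 : 1 - s * (x * q) = D1 at *
  generalize h2 : 1 - s * (x * q) * x = D2 at *
  generalize h3 : 1 - s * (x * q) * (x * q) = D3 at *
  generalize h4 : 1 - a * q = D4 at *
  field_simp
  subst h1 h2 h3 h4
  ring

section Connection

variable {q : ℝ} (hq0 : 0 < q) (hq1 : q < 1) {N n : ℕ} {a s : ℝ}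

include hq0 hq1

theorem qHahnCoeff_connection_right (hnN : n + 1 ≤ N)
    (ha : ∀ j, 1 - a * q * q ^ j ≠ 0) (hs : ∀ j, 1 - s * q ^ (n + 2) * q ^ j ≠ 0)
    {m : ℕ} (hm : m ≤ n + 1) (d : ℝ)
    (hd : d * ((1 - s * q ^ (n + 2) * q ^ n) * (1 - s * q ^ (n + 2) * q ^ (n + 1))) =
      (1 - (q ^ N)⁻¹ * q ^ n) * (1 - q ^ (n + 1)) * (1 - a * q * q ^ n) * (s * q ^ (n + 2))) :
    qHahnCoeff (n + 1) a s N q m =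
      qHahnCoeff (n + 1) a (s * q) N q m + d * qHahnCoeff n a (s * q) N q m := by
  have hqm : qPoch q q m ≠ 0 := qPoch_ne_zero fun j _ => (one_sub_pow_succ_pos hq0 hq1 j).ne'
  have hN : qPoch ((q ^ N)⁻¹) q m ≠ 0 :=
    qPoch_ne_zero fun j hj => (one_sub_inv_pow_mul_neg hq0 hq1 (by omega)).ne
  have ham : qPoch (a * q) q m ≠ 0 := qPoch_ne_zero fun j _ => ha j
  have hsn : qPoch (s * q ^ (n + 2)) q n ≠ 0 := qPoch_ne_zero fun j _ => hs j
  have hs0 : 1 - s * q ^ (n + 2) ≠ 0 := by simpa using hs 0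
  have hsn0 := hs n
  have hsn1 := hs (n + 1)
  have hqn : (1 - (q ^ (n + 1))⁻¹) ≠ 0 := by
    have := one_sub_inv_pow_mul_neg hq0 hq1 (Nat.succ_pos n)
    rw [pow_zero, mul_one] at this
    exact this.ne
  have hqn' : q ^ (n + 1) ≠ 0 := (pow_pos hq0 _).ne'
  have hqq : (q ^ n)⁻¹ = (q ^ (n + 1))⁻¹ * q := by
    rw [pow_succ, mul_inv, mul_assoc, inv_mul_cancel₀ hq0.ne', mul_one]
  have e1 : s * q * q ^ (n + 1 + 1) = s * q ^ (n + 2) * q := by ring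
  have e2 : s * q * q ^ (n + 1) = s * q ^ (n + 2) := by ring
  have hd' : d = (1 - (q ^ N)⁻¹ * q ^ n) * (1 - q ^ (n + 1)) * (1 - a * q * q ^ n) *
      (s * q ^ (n + 2)) /
      ((1 - s * q ^ (n + 2) * q ^ n) * (1 - s * q ^ (n + 2) * q ^ (n + 1))) := by
    rw [← hd]; field_simp
  unfold qHahnCoeff
  rw [e1, e2, show s * q ^ (n + 1 + 1) = s * q ^ (n + 2) from rfl, hqq,
    qPoch_mul_eq_div hs0, qPoch_mul_eq_div hs0, qPoch_mul_eq_div hqn,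
    qPoch_succ (a * q) q n,
    qPoch_succ (s * q ^ (n + 2)) q n, qPoch_succ ((q ^ N)⁻¹) q n, hd']
  generalize qPoch (a * q) q n = A0
  generalize qPoch ((q ^ (n + 1))⁻¹) q m = U
  generalize qPoch ((q ^ N)⁻¹) q n = R0
  generalize qPoch (s * q ^ (n + 2)) q m = S
  generalize qPoch (s * q ^ (n + 2)) q n = S0 at *
  generalize qPoch (a * q) q m = A at *
  generalize qPoch q q m = Z at *
  generalize qPoch ((q ^ N)⁻¹) q m = RN at *
  generalize (q ^ N)⁻¹ = r at *
  simp only [pow_succ] at *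
  generalize q ^ n = x at *
  generalize q ^ m = y at *
  have hx : x ≠ 0 := left_ne_zero_of_mul hqn'
  have hq := hq0.ne'
  have hqn2 : x * q - 1 ≠ 0 := by
    intro h; apply hqn; rw [sub_eq_zero.mp h]; simp
  have f1 : 1 - (x * q)⁻¹ = (x * q - 1) / (x * q) := by field_simp
  have f2 : 1 - (x * q)⁻¹ * y = (x * q - y) / (x * q) := by field_simp
  rw [f1, f2]
  clear f1 f2 hd' hd hqq e1 e2 hqn hs ha hqn'
  generalize h1 : 1 - s * (x * q * q) = D1 at *
  generalize h2 : 1 - s * (x * q * q) * x = D2 at *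
  generalize h3 : 1 - s * (x * q * q) * (x * q) = D3 at *
  generalize h6 : x * q - 1 = D6 at *
  field_simp
  subst h1 h2 h3 h6
  ring

/-- Multiplication by `X - aq` sends `(X; q)_k` to a combination of the basis elements `k` and `k +
1`, so index `k + 1` collects two contributions. Index `0` collects only one and is treated in
`qHahnCoeff_christoffel_zero`. -/
theorem qHahnCoeff_christoffel_succ (hnN : n < N)
    (ha : ∀ j, 1 - a * q * q ^ j ≠ 0) (hs : ∀ j, 1 - s * q ^ (n + 1) * q ^ j ≠ 0)
    {k : ℕ} (hk : k ≤ n) (e : ℝ)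
    (he : e * ((1 - s * q ^ (n + 1) * q ^ n) * (1 - s * q ^ (n + 1) * q ^ (n + 1))) =
      (1 - a * q * q ^ n) * (1 - s * q ^ (n + 1)) *
        ((q ^ N)⁻¹ * q ^ n - s * q ^ (n + 1) * q ^ (n + 1))) :
    ((q ^ (k + 1))⁻¹ - a * q) * qHahnCoeff n (a * q) (s * q) N q (k + 1)
        - (q ^ k)⁻¹ * qHahnCoeff n (a * q) (s * q) N q k =
      qHahnCoeff (n + 1) a s N q (k + 1) + e * qHahnCoeff n a s N q (k + 1) := by
  have hqm : qPoch q q k ≠ 0 := qPoch_ne_zero fun j _ => (one_sub_pow_succ_pos hq0 hq1 j).ne'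
  have hqk := (one_sub_pow_succ_pos hq0 hq1 k).ne'
  have hN : qPoch ((q ^ N)⁻¹) q k ≠ 0 :=
    qPoch_ne_zero fun j hj => (one_sub_inv_pow_mul_neg hq0 hq1 (by omega)).ne
  have hNk := (one_sub_inv_pow_mul_neg (N := N) (j := k) hq0 hq1 (by omega)).ne
  have ham : qPoch (a * q) q k ≠ 0 := qPoch_ne_zero fun j _ => ha j
  have hsn : qPoch (s * q ^ (n + 1)) q n ≠ 0 := qPoch_ne_zero fun j _ => hs j
  have ha0 : 1 - a * q ≠ 0 := by simpa using ha 0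
  have hak := ha k
  have hak1 := ha (k + 1)
  have hs0 : 1 - s * q ^ (n + 1) ≠ 0 := by simpa using hs 0
  have hsn0 := hs n
  have hsn1 := hs (n + 1)
  have hqn' : q ^ (n + 1) ≠ 0 := (pow_pos hq0 _).ne'
  have hqk' : q ^ (k + 1) ≠ 0 := (pow_pos hq0 _).ne'
  have hqq : (q ^ n)⁻¹ = (q ^ (n + 1))⁻¹ * q := by
    rw [pow_succ, mul_inv, mul_assoc, inv_mul_cancel₀ hq0.ne', mul_one]
  have e1 : s * q * q ^ (n + 1) = s * q ^ (n + 1) * q := by ring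
  have e2 : s * q ^ (n + 1 + 1) = s * q ^ (n + 1) * q := by ring
  have he' : e = (1 - a * q * q ^ n) * (1 - s * q ^ (n + 1)) *
        ((q ^ N)⁻¹ * q ^ n - s * q ^ (n + 1) * q ^ (n + 1)) /
      ((1 - s * q ^ (n + 1) * q ^ n) * (1 - s * q ^ (n + 1) * q ^ (n + 1))) :=
    eq_div_of_mul_eq (mul_ne_zero hsn0 hsn1) he
  unfold qHahnCoeff
  rw [e1, e2, qPoch_succ' ((q ^ (n + 1))⁻¹) q k, ← hqq,
    qPoch_mul_eq_div hs0, qPoch_mul_eq_div hs0, qPoch_mul_eq_div hs0, qPoch_mul_eq_div hs0,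
    qPoch_mul_eq_div ha0, qPoch_mul_eq_div ha0, qPoch_mul_eq_div ha0,
    qPoch_succ (a * q) q n, qPoch_succ (a * q) q k, qPoch_succ ((q ^ n)⁻¹) q k,
    qPoch_succ (s * q ^ (n + 1)) q n, qPoch_succ (s * q ^ (n + 1)) q k,
    qPoch_succ ((q ^ N)⁻¹) q n, qPoch_succ ((q ^ N)⁻¹) q k, qPoch_succ q q k, he']
  clear he' he hqq e1 e2 hs ha
  generalize qPoch (a * q) q n = A0
  generalize qPoch ((q ^ n)⁻¹) q k = U
  generalize qPoch ((q ^ N)⁻¹) q n = R0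
  generalize qPoch (s * q ^ (n + 1)) q k = S
  generalize qPoch (s * q ^ (n + 1)) q n = S0 at *
  generalize qPoch (a * q) q k = A at *
  generalize qPoch q q k = Z at *
  generalize qPoch ((q ^ N)⁻¹) q k = RN at *
  generalize (q ^ N)⁻¹ = r at *
  simp only [pow_succ] at *
  generalize q ^ n = x at *
  generalize q ^ k = y at *
  have hx : x ≠ 0 := left_ne_zero_of_mul hqn'
  have hy : y ≠ 0 := left_ne_zero_of_mul hqk'
  have hq := hq0.ne'
  have f1 : 1 - (x * q)⁻¹ = (x * q - 1) / (x * q) := by field_simp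
  have f2 : 1 - x⁻¹ * y = (x - y) / x := by field_simp
  rw [f1, f2]
  clear f1 f2
  generalize h1 : 1 - s * (x * q) = D1 at *
  generalize h2 : 1 - s * (x * q) * x = D2 at *
  generalize h3 : 1 - s * (x * q) * (x * q) = D3 at *
  generalize h4 : 1 - a * q = D4 at *
  generalize h5 : 1 - a * q * y = D5 at *
  generalize h6 : 1 - q * y = D6 at *
  generalize h7 : 1 - r * y = D7 at *
  generalize h8 : 1 - a * q * (y * q) = D8 at *
  field_simp
  subst h1 h2 h3 h4 h5 h6 h7 h8
  ring

end Connection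

/-! ### Relations between polynomials with shifted parameters. -/

theorem X_sub_C_mul_qPoch_X {q : ℝ} (hq : q ≠ 0) (t : ℝ) (m : ℕ) :
    (X - C t) * qPoch X (C q) m =
      C ((q ^ m)⁻¹ - t) * qPoch X (C q) m - C ((q ^ m)⁻¹) * qPoch X (C q) (m + 1) := by
  have h : (C ((q ^ m)⁻¹) : ℝ[X]) * C q ^ m = 1 := by
    rw [← C_pow, ← C_mul, inv_mul_cancel₀ (pow_ne_zero _ hq), C_1]
  rw [qPoch_succ, C_sub]
  linear_combination (-X * qPoch X (C q) m) * h

section Relations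

variable {q : ℝ} (hq0 : 0 < q) (hq1 : q < 1) {N n : ℕ} {a b : ℝ}

include hq0 hq1

theorem qHahn_connection_left (hnN : n + 1 ≤ N)
    (ha : ∀ j, 1 - a * q * q ^ j ≠ 0) (hs : ∀ j, 1 - a * b * q ^ (n + 2) * q ^ j ≠ 0) (c : ℝ)
    (hc : c * ((1 - a * b * q ^ (n + 2) * q ^ n) * (1 - a * b * q ^ (n + 2) * q ^ (n + 1))) =
      -(1 - (q ^ N)⁻¹ * q ^ n) * (1 - q ^ (n + 1)) * (a * q - a * b * q ^ (n + 2))) :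
    qHahn (n + 1) a b N q = qHahn (n + 1) (a * q) b N q + C c * qHahn n (a * q) b N q := by
  have hM : n + 1 < n + 2 := by omega
  rw [qHahn_eq_sum _ _ _ _ hq0.ne' hM, qHahn_eq_sum _ _ _ _ hq0.ne' hM,
    qHahn_eq_sum n _ _ _ hq0.ne' (by omega : n < n + 2), Finset.mul_sum, ← Finset.sum_add_distrib]
  refine Finset.sum_congr rfl fun m hm => ?_
  rw [mul_right_comm a q b, qHahnCoeff_connection_left hq0 hq1 hnN ha hs
    (by have := Finset.mem_range.mp hm; omega) c hc, C_add, C_mul]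
  ring

theorem qHahn_connection_right (hnN : n + 1 ≤ N)
    (ha : ∀ j, 1 - a * q * q ^ j ≠ 0) (hs : ∀ j, 1 - a * b * q ^ (n + 2) * q ^ j ≠ 0) (d : ℝ)
    (hd : d * ((1 - a * b * q ^ (n + 2) * q ^ n) * (1 - a * b * q ^ (n + 2) * q ^ (n + 1))) =
      (1 - (q ^ N)⁻¹ * q ^ n) * (1 - q ^ (n + 1)) * (1 - a * q * q ^ n) *
        (a * b * q ^ (n + 2))) :
    qHahn (n + 1) a b N q = qHahn (n + 1) a (b * q) N q + C d * qHahn n a (b * q) N q := by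
  have hM : n + 1 < n + 2 := by omega
  rw [qHahn_eq_sum _ _ _ _ hq0.ne' hM, qHahn_eq_sum _ _ _ _ hq0.ne' hM,
    qHahn_eq_sum n _ _ _ hq0.ne' (by omega : n < n + 2), Finset.mul_sum, ← Finset.sum_add_distrib]
  refine Finset.sum_congr rfl fun m hm => ?_
  rw [← mul_assoc a b q, qHahnCoeff_connection_right hq0 hq1 hnN ha hs
    (by have := Finset.mem_range.mp hm; omega) d hd, C_add, C_mul]
  ring

theorem qHahn_christoffel (hnN : n < N)
    (ha : ∀ j, 1 - a * q * q ^ j ≠ 0) (hs : ∀ j, 1 - a * b * q ^ (n + 1) * q ^ j ≠ 0) (e : ℝ)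
    (he : e * ((1 - a * b * q ^ (n + 1) * q ^ n) * (1 - a * b * q ^ (n + 1) * q ^ (n + 1))) =
      (1 - a * q * q ^ n) * (1 - a * b * q ^ (n + 1)) *
        ((q ^ N)⁻¹ * q ^ n - a * b * q ^ (n + 1) * q ^ (n + 1))) :
    (X - C (a * q)) * qHahn n (a * q) b N q = qHahn (n + 1) a b N q + C e * qHahn n a b N q := by
  have h1 : (X - C (a * q)) * qHahn n (a * q) b N q =
      ∑ m ∈ Finset.range (n + 2),
          C (((q ^ m)⁻¹ - a * q) * qHahnCoeff n (a * q) (a * b * q) N q m) * qPoch X (C q) m -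
        ∑ m ∈ Finset.range (n + 1),
          C ((q ^ m)⁻¹ * qHahnCoeff n (a * q) (a * b * q) N q m) * qPoch X (C q) (m + 1) := by
    rw [Finset.sum_range_succ, qHahnCoeff_eq_zero _ _ _ hq0.ne' (Nat.lt_succ_self n), mul_zero, C_0,
      zero_mul, add_zero, ← Finset.sum_sub_distrib,
      qHahn_eq_sum _ _ _ _ hq0.ne' (Nat.lt_succ_self n), Finset.mul_sum, mul_right_comm a q b]
    refine Finset.sum_congr rfl fun m _ => ?_
    rw [mul_left_comm, X_sub_C_mul_qPoch_X hq0.ne', C_mul, C_mul]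
    ring
  rw [h1, qHahn_eq_sum (n + 1) _ _ _ hq0.ne' (by omega : n + 1 < n + 2),
    qHahn_eq_sum n a _ _ hq0.ne' (by omega : n < n + 2), Finset.mul_sum,
    Finset.sum_range_succ', add_sub_right_comm, ← Finset.sum_sub_distrib,
    ← Finset.sum_add_distrib, Finset.sum_range_succ' _ (n + 1)]
  congr 1
  · refine Finset.sum_congr rfl fun k hk => ?_
    have h := qHahnCoeff_christoffel_succ hq0 hq1 hnN ha hs
      (by have := Finset.mem_range.mp hk; omega : k ≤ n) e he
    have h' := congrArg (fun t => C t * qPoch X (C q) (k + 1)) h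
    simp only [C_add, C_sub, C_mul] at h' ⊢
    linear_combination h'
  · have h := qHahnCoeff_christoffel_zero ha hs e he
    have h' := congrArg (fun t => C t * qPoch X (C q) 0) h
    simp only [C_add, C_sub, C_mul, pow_zero, inv_one, C_1] at h' ⊢
    linear_combination h'

end Relations

theorem qHahn_zero (a b : ℝ) (N : ℕ) (q : ℝ) : qHahn 0 a b N q = 1 := by
  simp [qHahn, qPoch_zero]

/-- This is the Christoffel formula for `n = 0` after cancelling `1 - abq`, a factor that may
vanish. -/
theorem qHahn_one {q : ℝ} (hq0 : 0 < q) (hq1 : q < 1) {N : ℕ} (hN : 1 ≤ N) {a b : ℝ}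
    (ha : 1 - a * q ≠ 0) (hs : 1 - a * b * q ^ 2 ≠ 0) :
    qHahn 1 a b N q =
      X - C (a * q) - C ((1 - a * q) * ((q ^ N)⁻¹ - a * b * q ^ 2) / (1 - a * b * q ^ 2)) := by
  have hr : 1 - (q ^ N)⁻¹ ≠ 0 := by
    simpa using (one_sub_inv_pow_mul_neg hq0 hq1 (by omega : 0 < N)).ne
  have hq : 1 - q ≠ 0 := by linarith
  have hq' := hq0.ne'
  have e0 : qHahnCoeff 1 a (a * b) N q 0 =
      (1 - a * q) * (1 - (q ^ N)⁻¹) / (1 - a * b * q ^ 2) := by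
    simp [qHahnCoeff, qPoch]
  have e1 : qHahnCoeff 1 a (a * b) N q 1 = -1 := by
    simp only [qHahnCoeff, qPoch, Finset.prod_range_one, pow_zero, mul_one, pow_one,
      one_add_one_eq_two]
    rw [show 1 - q⁻¹ = -(1 - q) / q by field_simp; ring]
    generalize (q ^ N)⁻¹ = r at *
    generalize 1 - r = D1 at *
    generalize 1 - a * q = D2 at *
    generalize 1 - a * b * q ^ 2 = D3 at *
    generalize 1 - q = D4 at *
    field_simp
  rw [qHahn_eq_sum 1 a b N hq' (by omega : 1 < 2), Finset.sum_range_succ, Finset.sum_range_one,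
    e0, e1, qPoch_zero, qPoch_succ, qPoch_zero, pow_zero]
  have : (1 - a * q) * (1 - (q ^ N)⁻¹) / (1 - a * b * q ^ 2) =
      1 - a * q - (1 - a * q) * ((q ^ N)⁻¹ - a * b * q ^ 2) / (1 - a * b * q ^ 2) := by
    rw [eq_sub_iff_add_eq, ← add_div, div_eq_iff hs]
    ring
  rw [this]
  simp only [C_sub, C_neg, C_1]
  ring

/-! ### Locating zeros by sign changes. -/

theorem isOrderedZeros_of_eval_eq_zero {p : ℝ[X]} {n : ℕ} {x : ℕ → ℝ} (hm : p.Monic)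
    (hd : p.natDegree = n) (hx : StrictMonoOn x (Set.Icc 1 n))
    (hr : ∀ j ∈ Finset.Icc 1 n, p.eval (x j) = 0) : IsOrderedZeros p n x := by
  refine ⟨by rw [degree_eq_natDegree hm.ne_zero, hd], hx, ?_⟩
  have hnd : ((Finset.Icc 1 n).val.map x).Nodup := by
    refine Multiset.Nodup.map_on (fun i hi j hj h => ?_) (Finset.Icc 1 n).nodup
    exact hx.injOn (by simpa using hi) (by simpa using hj) h
  refine (Multiset.eq_of_le_of_card_le ((Multiset.le_iff_subset hnd).mpr fun t ht => ?_) ?_).symm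
  · obtain ⟨j, hj, rfl⟩ := Multiset.mem_map.mp ht
    exact (mem_roots hm.ne_zero).mpr (hr j hj)
  · have := p.card_roots'
    simpa [hd] using this

/-- The intermediate value theorem gives one zero in each of `n` successive disjoint intervals, and
the degree allows no more. -/
theorem exists_isOrderedZeros {p : ℝ[X]} {n : ℕ} (hm : p.Monic) (hd : p.natDegree = n)
    {l r : ℕ → ℝ} (hlr : ∀ j ∈ Finset.Icc 1 n, l j < r j)
    (hp : ∀ j ∈ Finset.Icc 1 n, p.eval (l j) * p.eval (r j) < 0)
    (hrl : ∀ j, 1 ≤ j → j < n → r j ≤ l (j + 1)) :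
    ∃ y : ℕ → ℝ, IsOrderedZeros p n y ∧ ∀ j ∈ Finset.Icc 1 n, l j < y j ∧ y j < r j := by
  have h : ∀ j, ∃ t, j ∈ Finset.Icc 1 n → (l j < t ∧ t < r j) ∧ p.eval t = 0 := by
    intro j
    by_cases hj : j ∈ Finset.Icc 1 n
    · have h1 := hlr j hj
      have h2 := hp j hj
      have hc : ContinuousOn (fun t => p.eval t) (Set.Icc (l j) (r j)) := p.continuous.continuousOn
      rcases lt_or_ge (p.eval (l j)) 0 with h3 | h3
      · have h4 : 0 < p.eval (r j) := by nlinarith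
        obtain ⟨t, ht, ht'⟩ := intermediate_value_Ioo h1.le hc ⟨h3, h4⟩
        exact ⟨t, fun _ => ⟨ht, ht'⟩⟩
      · have h4 : p.eval (r j) < 0 := by nlinarith
        have h5 : 0 < p.eval (l j) := by nlinarith
        obtain ⟨t, ht, ht'⟩ := intermediate_value_Ioo' h1.le hc ⟨h4, h5⟩
        exact ⟨t, fun _ => ⟨ht, ht'⟩⟩
    · exact ⟨0, fun h => absurd h hj⟩
  choose y hy using h
  refine ⟨y, isOrderedZeros_of_eval_eq_zero hm hd ?_ fun j hj => (hy j hj).2,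
    fun j hj => (hy j hj).1⟩
  refine strictMonoOn_of_lt_add_one Set.ordConnected_Icc fun j _ hj hj' => ?_
  have h1 := hy j (by simpa using hj)
  have h2 := hy (j + 1) (by simpa using hj')
  have h3 := hrl j hj.1 (by have := hj'.2; omega)
  linarith [h1.1.2, h2.1.1]

theorem IsOrderedZeros.eval_eq_prod {p : ℝ[X]} {n : ℕ} {x : ℕ → ℝ} (h : IsOrderedZeros p n x)
    (hm : p.Monic) (t : ℝ) : p.eval t = ∏ j ∈ Finset.Icc 1 n, (t - x j) := by
  have hc : p.roots.card = p.natDegree := by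
    rw [h.2.2, natDegree_eq_of_degree_eq_some h.1]; simp
  conv_lhs => rw [← prod_multiset_X_sub_C_of_monic_of_roots_card_eq hm hc, h.2.2]
  rw [Multiset.map_map, ← Finset.prod_eq_multiset_prod, eval_prod]
  simp

theorem IsOrderedZeros.eval_eq_zero {p : ℝ[X]} {n : ℕ} {x : ℕ → ℝ} (h : IsOrderedZeros p n x)
    {j : ℕ} (hj : j ∈ Finset.Icc 1 n) : p.eval (x j) = 0 := by
  have : x j ∈ p.roots := by
    rw [h.2.2]; exact Multiset.mem_map_of_mem x hj
  exact (mem_roots'.mp this).2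

/-- Each zero to the right of `t` contributes one negative factor; `k` counts those to the left. -/
theorem IsOrderedZeros.sign_eval {p : ℝ[X]} {n k : ℕ} {x : ℕ → ℝ} (h : IsOrderedZeros p n x)
    (hm : p.Monic) {t : ℝ} (h1 : ∀ j ∈ Finset.Icc 1 n, j ≤ k → x j < t)
    (h2 : ∀ j ∈ Finset.Icc 1 n, k < j → t < x j) : 0 < (-1) ^ (n - k) * p.eval t := by
  rw [h.eval_eq_prod hm]
  -- Truncated subtraction is intended: for `m ≤ k` all factors are positive and the exponent is
  -- `0`.
  suffices H : ∀ m ≤ n, 0 < (-1) ^ (m - k) * ∏ j ∈ Finset.Icc 1 m, (t - x j) from H n le_rfl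
  intro m
  induction m with
  | zero => simp
  | succ m ih =>
    intro hmn
    have ih := ih (by omega)
    have hmem : m + 1 ∈ Finset.Icc 1 n := Finset.mem_Icc.mpr ⟨by omega, hmn⟩
    rw [Finset.prod_Icc_succ_top (by omega)]
    rcases le_or_gt (m + 1) k with hk | hk
    · have h3 := h1 _ hmem hk
      rw [Nat.sub_eq_zero_of_le (by omega : m ≤ k)] at ih
      rw [Nat.sub_eq_zero_of_le hk]
      have h4 := sub_pos.mpr h3
      rw [← mul_assoc]
      exact mul_pos ih h4
    · have h3 := h2 _ hmem hk
      rw [show m + 1 - k = (m - k) + 1 by omega, pow_succ]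
      nlinarith

theorem mul_neg_of_alternating {k : ℕ} {u v : ℝ} (hu : 0 < (-1) ^ (k + 1) * u)
    (hv : 0 < (-1) ^ k * v) : u * v < 0 := by
  have h := mul_pos hu hv
  rcases neg_one_pow_eq_or ℝ k with h1 | h1 <;> rw [pow_succ, h1] at h <;> linarith

/-- `P` and `Q` are monic of degrees `n + 1` and `n`, with interlacing real simple zeros. -/
structure InterlacedZeros (P Q : ℝ[X]) (n : ℕ) (x w : ℕ → ℝ) : Prop where
  monic_left : P.Monic
  monic_right : Q.Monic
  zeros_left : IsOrderedZeros P (n + 1) x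
  zeros_right : IsOrderedZeros Q n w
  left_lt : ∀ j ∈ Finset.Icc 1 n, x j < w j
  lt_succ : ∀ j ∈ Finset.Icc 1 n, w j < x (j + 1)

/-! ### Consequences of interlacing. -/

namespace InterlacedZeros

variable {P Q : ℝ[X]} {n : ℕ} {x w : ℕ → ℝ} (h : InterlacedZeros P Q n x w)

include h

theorem sign_right {j : ℕ} (hj : j ∈ Finset.Icc 1 (n + 1)) :
    0 < (-1) ^ (n + 1 - j) * Q.eval (x j) := by
  obtain ⟨hj1, hj2⟩ := Finset.mem_Icc.mp hj
  have := h.zeros_right.sign_eval h.monic_right (k := j - 1) (t := x j) ?_ ?_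
  · rwa [show n - (j - 1) = n + 1 - j by omega] at this
  · intro i hi hij
    have hi' := Finset.mem_Icc.mp hi
    refine (h.lt_succ i hi).trans_le (h.zeros_left.2.1.monotoneOn ?_ ?_ (by omega))
    · exact ⟨by omega, by omega⟩
    · exact ⟨by omega, by omega⟩
  · intro i hi hij
    have hi' := Finset.mem_Icc.mp hi
    refine lt_of_le_of_lt (h.zeros_left.2.1.monotoneOn ?_ ?_ (by omega)) (h.left_lt i hi)
    · exact ⟨by omega, by omega⟩
    · exact ⟨by omega, by omega⟩

theorem sign_left {j : ℕ} (hj : j ∈ Finset.Icc 1 n) :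
    0 < (-1) ^ (n + 1 - j) * P.eval (w j) := by
  obtain ⟨hj1, hj2⟩ := Finset.mem_Icc.mp hj
  refine h.zeros_left.sign_eval h.monic_left ?_ ?_
  · intro i hi hij
    have hi' := Finset.mem_Icc.mp hi
    refine lt_of_le_of_lt (h.zeros_left.2.1.monotoneOn ?_ ?_ hij) (h.left_lt j hj)
    · exact ⟨by omega, by omega⟩
    · exact ⟨by omega, by omega⟩
  · intro i hi hij
    have hi' := Finset.mem_Icc.mp hi
    refine lt_of_lt_of_le (h.lt_succ j hj) (h.zeros_left.2.1.monotoneOn ?_ ?_ (by omega))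
    · exact ⟨by omega, by omega⟩
    · exact ⟨by omega, by omega⟩

/-- At a zero of `P` the recurrence reduces to `T = -BQ`, whose signs alternate along these zeros.
The signs at `L` and `R` supply the two outer intervals. -/
theorem exists_succ {T : ℝ[X]} (hT : T.Monic) (hTd : T.natDegree = n + 2) {A B L R : ℝ}
    (hB : 0 < B) (hrec : T = (X - C A) * P - C B * Q)
    (hx : ∀ j ∈ Finset.Icc 1 (n + 1), L < x j ∧ x j < R)
    (hL : 0 < (-1) ^ (n + 2) * T.eval L) (hR : 0 < T.eval R) :
    ∃ y, InterlacedZeros T P (n + 1) y x ∧ ∀ j ∈ Finset.Icc 1 (n + 2), L < y j ∧ y j < R := by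
  -- The zeros of `P` padded by the endpoints: consecutive values bound the `n + 2` intervals.
  let v : ℕ → ℝ := fun j => if j = 0 then L else if j = n + 2 then R else x j
  have hv : ∀ j ∈ Finset.Icc 1 (n + 1), v j = x j := fun j hj => by
    obtain ⟨h1, h2⟩ := Finset.mem_Icc.mp hj
    simp only [v]
    rw [if_neg (by omega), if_neg (by omega)]
  have hv0 : v 0 = L := by simp [v]
  have hv1 : v (n + 2) = R := by simp [v]
  have hsign : ∀ j ≤ n + 2, 0 < (-1) ^ (n + 2 - j) * T.eval (v j) := by
    intro j hj
    rcases Nat.eq_zero_or_pos j with rfl | hj0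
    · rwa [hv0]
    rcases hj.eq_or_lt with rfl | hj1
    · simpa [hv1] using hR
    have hmem : j ∈ Finset.Icc 1 (n + 1) := Finset.mem_Icc.mpr ⟨hj0, by omega⟩
    have h1 := h.sign_right hmem
    rw [hv j hmem, hrec, eval_sub, eval_mul, eval_mul, eval_C, h.zeros_left.eval_eq_zero hmem,
      show n + 2 - j = n + 1 - j + 1 by omega, pow_succ]
    nlinarith
  have hvL : ∀ j ≤ n + 1, L ≤ v j := by
    intro j hj
    rcases Nat.eq_zero_or_pos j with rfl | hj0
    · exact hv0.ge
    have hmem : j ∈ Finset.Icc 1 (n + 1) := Finset.mem_Icc.mpr ⟨hj0, hj⟩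
    rw [hv j hmem]; exact (hx j hmem).1.le
  have hvR : ∀ j, 1 ≤ j → j ≤ n + 2 → v j ≤ R := by
    intro j hj hj'
    rcases hj'.eq_or_lt with rfl | hj1
    · exact hv1.le
    have hmem : j ∈ Finset.Icc 1 (n + 1) := Finset.mem_Icc.mpr ⟨hj, by omega⟩
    rw [hv j hmem]; exact (hx j hmem).2.le
  obtain ⟨y, hy, hyv⟩ := exists_isOrderedZeros (l := fun j => v (j - 1)) (r := v) hT hTd
    (fun j hj => by
      obtain ⟨h1, h2⟩ := Finset.mem_Icc.mp hj
      have hmem1 : 1 ∈ Finset.Icc 1 (n + 1) := by simp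
      rcases h1.eq_or_lt with rfl | h1
      · change v 0 < v 1
        rw [hv0, hv 1 hmem1]
        exact (hx 1 hmem1).1
      have hmem : j - 1 ∈ Finset.Icc 1 (n + 1) := Finset.mem_Icc.mpr ⟨by omega, by omega⟩
      change v (j - 1) < v j
      rw [hv _ hmem]
      rcases h2.eq_or_lt with rfl | h2
      · rw [hv1]; exact (hx _ hmem).2
      · rw [hv j (Finset.mem_Icc.mpr ⟨by omega, by omega⟩)]
        exact h.zeros_left.2.1 ⟨by omega, by omega⟩ ⟨by omega, by omega⟩ (by omega))
    (fun j hj => by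
      obtain ⟨h1, h2⟩ := Finset.mem_Icc.mp hj
      have h3 := hsign (j - 1) (by omega)
      rw [show n + 2 - (j - 1) = n + 2 - j + 1 by omega] at h3
      exact mul_neg_of_alternating h3 (hsign j h2))
    (fun j _ _ => le_rfl)
  refine ⟨y, ⟨hT, h.monic_left, hy, h.zeros_left, fun j hj => ?_, fun j hj => ?_⟩, fun j hj => ?_⟩
  · obtain ⟨h1, h2⟩ := Finset.mem_Icc.mp hj
    have := (hyv j (Finset.mem_Icc.mpr ⟨by omega, by omega⟩)).2
    rwa [hv j hj] at this
  · obtain ⟨h1, h2⟩ := Finset.mem_Icc.mp hj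
    have := (hyv (j + 1) (Finset.mem_Icc.mpr ⟨by omega, by omega⟩)).1
    change v j < _ at this
    rwa [hv j hj] at this
  · obtain ⟨h1, h2⟩ := Finset.mem_Icc.mp hj
    have h3 := hyv j hj
    exact ⟨(hvL (j - 1) (by omega)).trans_lt h3.1, h3.2.trans_le (hvR j h1 h2)⟩

/-- `p` has the sign of `Q` at the zeros of `P` and equals `P` at those of `Q`, hence changes sign
on each `(w_{j-1}, x_j)`. The remaining zero lies below `L`, where the sign of `p` is opposite to
that at `-∞`. -/
theorem exists_zeros_add {p : ℝ[X]} (hp : p.Monic) (hpd : p.natDegree = n + 1) {c L : ℝ}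
    (hc : 0 < c) (hpPQ : p = P + C c * Q) (hL : L < x 1) (hpL : 0 < (-1) ^ n * p.eval L) :
    ∃ y, IsOrderedZeros p (n + 1) y ∧ y 1 < L ∧ (∀ j ∈ Finset.Icc 1 (n + 1), y j < x j) ∧
      ∀ j ∈ Finset.Icc 1 n, w j < y (j + 1) := by
  obtain ⟨M, hML, hM⟩ : ∃ M < L, 0 < (-1) ^ (n + 1) * p.eval M := by
    -- The behaviour of `p` at `-∞` is read off from the monic polynomial `(-1)^(n+1) p(-X)` at
    -- `+∞`.
    have h1 : ((C ((-1) ^ (n + 1)) * p.comp (-X)) : ℝ[X]).leadingCoeff = 1 := by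
      rw [leadingCoeff_mul, leadingCoeff_C, leadingCoeff_comp (by simp), hp.leadingCoeff, hpd,
        leadingCoeff_neg, leadingCoeff_X, one_mul, ← mul_pow]
      simp
    have h2 : ((C ((-1) ^ (n + 1)) * p.comp (-X)) : ℝ[X]).natDegree = n + 1 := by
      rw [natDegree_C_mul (by simp), natDegree_comp, hpd, natDegree_neg, natDegree_X, mul_one]
    have h3 := tendsto_atTop_of_leadingCoeff_nonneg (C ((-1) ^ (n + 1)) * p.comp (-X))
      (natDegree_pos_iff_degree_pos.mp (by omega)) (by rw [h1]; exact zero_le_one)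
    obtain ⟨t, ht1, ht2⟩ := ((h3.eventually_gt_atTop 0).and
      (Filter.eventually_gt_atTop (-L))).exists
    refine ⟨-t, by linarith, ?_⟩
    simpa using ht1
  have hsx : ∀ j ∈ Finset.Icc 1 (n + 1), 0 < (-1) ^ (n + 1 - j) * p.eval (x j) := by
    intro j hj
    rw [hpPQ, eval_add, eval_mul, eval_C, h.zeros_left.eval_eq_zero hj, zero_add, mul_left_comm]
    exact mul_pos hc (h.sign_right hj)
  have hsw : ∀ j ∈ Finset.Icc 1 n, 0 < (-1) ^ (n + 1 - j) * p.eval (w j) := by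
    intro j hj
    rw [hpPQ, eval_add, eval_mul, h.zeros_right.eval_eq_zero hj, mul_zero, add_zero]
    exact h.sign_left hj
  let l : ℕ → ℝ := fun j => if j = 1 then M else w (j - 1)
  let r : ℕ → ℝ := fun j => if j = 1 then L else x j
  have hl1 : l 1 = M := by simp [l]
  have hr1 : r 1 = L := by simp [r]
  have hl : ∀ j, 1 < j → l j = w (j - 1) := fun j hj => if_neg (by omega)
  have hr : ∀ j, 1 < j → r j = x j := fun j hj => if_neg (by omega)
  have hrx : ∀ j, 1 ≤ j → r j ≤ x j := fun j hj => by
    rcases hj.eq_or_lt with rfl | hj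
    · exact hr1.trans_le hL.le
    · exact (hr j hj).le
  obtain ⟨y, hy, hyv⟩ := exists_isOrderedZeros (l := l) (r := r) hp hpd
    (fun j hj => by
      obtain ⟨h1, h2⟩ := Finset.mem_Icc.mp hj
      rcases h1.eq_or_lt with rfl | h1
      · rwa [hl1, hr1]
      · rw [hl j h1, hr j h1]
        have := h.lt_succ (j - 1) (Finset.mem_Icc.mpr ⟨by omega, by omega⟩)
        rwa [Nat.sub_add_cancel (by omega)] at this)
    (fun j hj => by
      obtain ⟨h1, h2⟩ := Finset.mem_Icc.mp hj
      rcases h1.eq_or_lt with rfl | h1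
      · rw [hl1, hr1]; exact mul_neg_of_alternating hM hpL
      · rw [hl j h1, hr j h1]
        have h3 := hsw (j - 1) (Finset.mem_Icc.mpr ⟨by omega, by omega⟩)
        rw [show n + 1 - (j - 1) = n + 1 - j + 1 by omega] at h3
        exact mul_neg_of_alternating h3 (hsx j hj))
    (fun j h1 h2 => by
      rw [hl (j + 1) (by omega), Nat.add_sub_cancel]
      exact (hrx j h1).trans (h.left_lt j (Finset.mem_Icc.mpr ⟨h1, by omega⟩)).le)
  refine ⟨y, hy, ?_, fun j hj => ?_, fun j hj => ?_⟩
  · have := (hyv 1 (by simp)).2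
    rwa [hr1] at this
  · exact (hyv j hj).2.trans_le (hrx j (Finset.mem_Icc.mp hj).1)
  · obtain ⟨h1, h2⟩ := Finset.mem_Icc.mp hj
    have := (hyv (j + 1) (Finset.mem_Icc.mpr ⟨by omega, by omega⟩)).1
    rwa [hl (j + 1) (by omega), Nat.add_sub_cancel] at this

/-- With `d < 0` the sign at each `x_j` is reversed, so the sign changes move to `(x_j, w_j)`. The
remaining zero lies above `R`, since `p(R) < 0` while `p` is eventually positive. -/
theorem exists_zeros_sub {p : ℝ[X]} (hp : p.Monic) (hpd : p.natDegree = n + 1) {d R : ℝ}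
    (hd : d < 0) (hpPQ : p = P + C d * Q) (hR : x (n + 1) < R) (hpR : p.eval R < 0) :
    ∃ z, IsOrderedZeros p (n + 1) z ∧ R < z (n + 1) ∧ (∀ j ∈ Finset.Icc 1 (n + 1), x j < z j) ∧
      ∀ j ∈ Finset.Icc 1 n, z j < w j := by
  obtain ⟨M, hMR, hM⟩ : ∃ M, R < M ∧ 0 < p.eval M := by
    have h3 := tendsto_atTop_of_leadingCoeff_nonneg p
      (natDegree_pos_iff_degree_pos.mp (by omega)) (by rw [hp.leadingCoeff]; exact zero_le_one)
    obtain ⟨t, ht1, ht2⟩ := ((h3.eventually_gt_atTop 0).and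
      (Filter.eventually_gt_atTop R)).exists
    exact ⟨t, ht2, ht1⟩
  have hsx : ∀ j ∈ Finset.Icc 1 (n + 1), 0 < (-1) ^ (n + 1 - j + 1) * p.eval (x j) := by
    intro j hj
    have h1 := h.sign_right hj
    rw [hpPQ, eval_add, eval_mul, eval_C, h.zeros_left.eval_eq_zero hj, pow_succ]
    nlinarith
  have hsw : ∀ j ∈ Finset.Icc 1 n, 0 < (-1) ^ (n + 1 - j) * p.eval (w j) := by
    intro j hj
    rw [hpPQ, eval_add, eval_mul, h.zeros_right.eval_eq_zero hj, mul_zero, add_zero]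
    exact h.sign_left hj
  let l : ℕ → ℝ := fun j => if j = n + 1 then R else x j
  let r : ℕ → ℝ := fun j => if j = n + 1 then M else w j
  have hl1 : l (n + 1) = R := by simp [l]
  have hr1 : r (n + 1) = M := by simp [r]
  have hl : ∀ j, j < n + 1 → l j = x j := fun j hj => if_neg (by omega)
  have hr : ∀ j, j < n + 1 → r j = w j := fun j hj => if_neg (by omega)
  have hlx : ∀ j ≤ n + 1, x j ≤ l j := fun j hj => by
    rcases hj.eq_or_lt with rfl | hj
    · exact hR.le.trans_eq hl1.symm
    · exact (hl j hj).ge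
  obtain ⟨z, hz, hzv⟩ := exists_isOrderedZeros (l := l) (r := r) hp hpd
    (fun j hj => by
      obtain ⟨h1, h2⟩ := Finset.mem_Icc.mp hj
      rcases h2.eq_or_lt with rfl | h2
      · rwa [hl1, hr1]
      · rw [hl j h2, hr j h2]
        exact h.left_lt j (Finset.mem_Icc.mpr ⟨by omega, by omega⟩))
    (fun j hj => by
      obtain ⟨h1, h2⟩ := Finset.mem_Icc.mp hj
      rcases h2.eq_or_lt with rfl | h2
      · rw [hl1, hr1]; exact mul_neg_of_neg_of_pos hpR hM
      · rw [hl j h2, hr j h2]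
        exact mul_neg_of_alternating (hsx j hj)
          (hsw j (Finset.mem_Icc.mpr ⟨by omega, by omega⟩)))
    (fun j h1 h2 => by
      rw [hr j h2]
      exact (h.lt_succ j (Finset.mem_Icc.mpr ⟨h1, by omega⟩)).le.trans (hlx _ (by omega)))
  refine ⟨z, hz, ?_, fun j hj => ?_, fun j hj => ?_⟩
  · have := (hzv (n + 1) (by simp)).1
    rwa [hl1] at this
  · exact (hlx j (Finset.mem_Icc.mp hj).2).trans_lt (hzv j hj).1
  · obtain ⟨h1, h2⟩ := Finset.mem_Icc.mp hj
    have := (hzv j (Finset.mem_Icc.mpr ⟨by omega, by omega⟩)).2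
    rwa [hr j (by omega)] at this

end InterlacedZeros

/-- Monic polynomials satisfying a three-term recurrence with positive coefficients, and with the
signs at `L` and `R` of polynomials whose zeros lie in `(L, R)`, have interlacing zeros there. -/
theorem exists_interlacedZeros_of_recurrence {P : ℕ → ℝ[X]} {N : ℕ} {L R : ℝ} (hLR : L < R)
    (hm : ∀ k ≤ N, (P k).Monic ∧ (P k).natDegree = k)
    (hL : ∀ k ≤ N, 0 < (-1) ^ k * (P k).eval L) (hR : ∀ k ≤ N, 0 < (P k).eval R)
    (hrec : ∀ k, k + 2 ≤ N → ∃ A B, 0 < B ∧ P (k + 2) = (X - C A) * P (k + 1) - C B * P k)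
    (n : ℕ) (hn : n + 1 ≤ N) :
    ∃ x w, InterlacedZeros (P (n + 1)) (P n) n x w ∧
      ∀ j ∈ Finset.Icc 1 (n + 1), L < x j ∧ x j < R := by
  induction n with
  | zero =>
    obtain ⟨x, hx, hx'⟩ := exists_isOrderedZeros (l := fun _ => L) (r := fun _ => R)
      (hm 1 hn).1 (hm 1 hn).2 (fun _ _ => hLR)
      (fun _ _ => mul_neg_of_alternating (k := 0) (hL 1 hn) (by simpa using hR 1 hn))
      (fun j h1 h2 => by omega)
    -- `P 0` has no zeros, so the second sequence is arbitrary.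
    refine ⟨x, x, ⟨(hm 1 hn).1, (hm 0 (by omega)).1, hx, ?_, by simp, by simp⟩, hx'⟩
    exact isOrderedZeros_of_eval_eq_zero (hm 0 (by omega)).1 (hm 0 (by omega)).2
      (fun i hi => absurd (hi.1.trans hi.2) (by omega)) (by simp)
  | succ n ih =>
    obtain ⟨x, w, hxw, hx⟩ := ih (by omega)
    obtain ⟨A, B, hB, hAB⟩ := hrec n hn
    obtain ⟨y, hy, hy'⟩ := hxw.exists_succ (hm _ hn).1 (hm _ hn).2 hB hAB hx (hL _ hn) (hR _ hn)
    exact ⟨y, x, hy, hy'⟩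

/-! ### Endpoint values, recurrence and interlacing for the q-Hahn polynomials. -/

theorem qHahn_eval_one (n : ℕ) (a b : ℝ) (N : ℕ) {q : ℝ} (hq : q ≠ 0) :
    (qHahn n a b N q).eval 1 =
      qPoch (a * q) q n * qPoch ((q ^ N)⁻¹) q n / qPoch (a * b * q ^ (n + 1)) q n := by
  rw [qHahn_eq_sum n a b N hq n.lt_succ_self, eval_finsetSum, Finset.sum_range_succ',
    Finset.sum_eq_zero]
  · simp [qHahnCoeff, qPoch_zero]
  · intro m _
    simp [qPoch_succ', eval_mul]

section Parameters

variable {q : ℝ} (hq0 : 0 < q) (hq1 : q < 1) {N n : ℕ} {a b : ℝ}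

include hq0 hq1

theorem one_sub_mul_pow_pos {t : ℝ} (ht0 : 0 < t) (ht1 : t < 1) (j : ℕ) : 0 < 1 - t * q ^ j := by
  have h1 : q ^ j ≤ 1 := pow_le_one₀ hq0.le hq1.le
  nlinarith

/-- For `2 ≤ k` one factor `q` goes to each of `a` and `b`. For `k = 1` positivity can fail, whence
the separate treatment of the lowest degrees. -/
theorem one_sub_mul_mul_pow_pos (ha0 : 0 < a) (ha1 : a * q < 1) (hb0 : 0 < b) (hb1 : b * q < 1)
    {k : ℕ} (hk : 2 ≤ k) (j : ℕ) : 0 < 1 - a * b * q ^ k * q ^ j := by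
  have h1 : q ^ (k - 2 + j) ≤ 1 := pow_le_one₀ hq0.le hq1.le
  have h2 : a * b * q ^ k * q ^ j = (a * q) * (b * q) * q ^ (k - 2 + j) := by
    rw [show k = k - 2 + 2 by omega]
    simp only [Nat.add_sub_cancel]
    ring
  have h3 : 0 < a * q := mul_pos ha0 hq0
  have h4 : 0 < b * q := mul_pos hb0 hq0
  have h5 : (a * q) * (b * q) < 1 := by nlinarith
  rw [h2]
  nlinarith [mul_pos h3 h4]

theorem exists_qHahn_christoffel (ha0 : 0 < a) (ha1 : a * q < 1) (hb0 : 0 < b) (hb1 : b * q < 1)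
    (hnN : n < N) : ∃ e, 0 < e ∧
      (X - C (a * q)) * qHahn n (a * q) b N q =
        qHahn (n + 1) a b N q + C e * qHahn n a b N q := by
  have ha : ∀ j, 0 < 1 - a * q * q ^ j := one_sub_mul_pow_pos hq0 hq1 (mul_pos ha0 hq0) ha1
  have hr : 1 < (q ^ N)⁻¹ * q ^ n := by
    have := one_sub_inv_pow_mul_neg hq0 hq1 hnN
    linarith
  rcases Nat.eq_zero_or_pos n with rfl | hn
  · have hs := one_sub_mul_mul_pow_pos hq0 hq1 ha0 ha1 hb0 hb1 le_rfl 0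
    have ha' := ha 0
    rw [pow_zero, mul_one] at hs ha' hr
    refine ⟨(1 - a * q) * ((q ^ N)⁻¹ - a * b * q ^ 2) / (1 - a * b * q ^ 2),
      div_pos (mul_pos ha' (by linarith)) hs, ?_⟩
    rw [qHahn_one hq0 hq1 hnN ha'.ne' hs.ne', qHahn_zero, qHahn_zero]
    ring
  · have hs := one_sub_mul_mul_pow_pos hq0 hq1 ha0 ha1 hb0 hb1 (by omega : 2 ≤ n + 1)
    have hs0 := hs 0
    rw [pow_zero, mul_one] at hs0
    have hd := mul_pos (hs n) (hs (n + 1))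
    refine ⟨_, ?_, qHahn_christoffel hq0 hq1 hnN (fun j => (ha j).ne') (fun j => (hs j).ne') _
      (div_mul_cancel₀ _ hd.ne')⟩
    have := hs (n + 1)
    exact div_pos (mul_pos (mul_pos (ha n) hs0) (by linarith)) hd

/-- The Christoffel formula gives the leading term inductively, with no computation of the top
coefficient. -/
theorem qHahn_monic (ha0 : 0 < a) (ha1 : a * q < 1) (hb0 : 0 < b) (hb1 : b * q < 1)
    (hnN : n ≤ N) : (qHahn n a b N q).Monic ∧ (qHahn n a b N q).natDegree = n := by
  induction n generalizing a with
  | zero => simp [qHahn_zero, monic_one]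
  | succ n ih =>
    obtain ⟨e, -, he⟩ := exists_qHahn_christoffel hq0 hq1 ha0 ha1 hb0 hb1 hnN
    have h1 := ih (mul_pos ha0 hq0) (by nlinarith [mul_pos ha0 hq0]) (by omega)
    have h2 := ih ha0 ha1 (by omega)
    have h3 : ((X - C (a * q)) * qHahn n (a * q) b N q).Monic := (monic_X_sub_C _).mul h1.1
    have h4 : ((X - C (a * q)) * qHahn n (a * q) b N q).natDegree = n + 1 := by
      rw [(monic_X_sub_C _).natDegree_mul h1.1, natDegree_X_sub_C, h1.2, add_comm]
    have h5 : (C e * qHahn n a b N q).natDegree <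
        ((X - C (a * q)) * qHahn n (a * q) b N q).natDegree := by
      rw [h4]
      exact (natDegree_C_mul_le _ _).trans_lt (by omega)
    have h6 : qHahn (n + 1) a b N q =
        (X - C (a * q)) * qHahn n (a * q) b N q - C e * qHahn n a b N q := by
      rw [he]; ring
    rw [h6]
    exact ⟨h3.sub_of_left (degree_lt_degree h5),
      by rw [natDegree_sub_eq_left_of_natDegree_lt h5, h4]⟩

theorem exists_qHahn_recurrence (ha0 : 0 < a) (ha1 : a * q < 1) (hb0 : 0 < b) (hb1 : b * q < 1)
    (hnN : n + 2 ≤ N) : ∃ A B, 0 < B ∧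
      qHahn (n + 2) a b N q = (X - C A) * qHahn (n + 1) a b N q - C B * qHahn n a b N q := by
  have ha : ∀ j, 0 < 1 - a * q * q ^ j := one_sub_mul_pow_pos hq0 hq1 (mul_pos ha0 hq0) ha1
  have hb := one_sub_mul_pow_pos hq0 hq1 (mul_pos hb0 hq0) hb1 n
  have hs := one_sub_mul_mul_pow_pos hq0 hq1 ha0 ha1 hb0 hb1 (by omega : 2 ≤ n + 2)
  have hr := one_sub_inv_pow_mul_neg hq0 hq1 (by omega : n < N)
  have hd := mul_pos (hs n) (hs (n + 1))
  have hq := one_sub_pow_succ_pos hq0 hq1 n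
  rw [← pow_succ'] at hq
  obtain ⟨e, he0, he⟩ := exists_qHahn_christoffel hq0 hq1 ha0 ha1 hb0 hb1 (by omega : n < N)
  obtain ⟨e', -, he'⟩ := exists_qHahn_christoffel hq0 hq1 ha0 ha1 hb0 hb1 (by omega : n + 1 < N)
  have hc := qHahn_connection_left hq0 hq1 (by omega : n + 1 ≤ N) (fun j => (ha j).ne')
    (fun j => (hs j).ne') _ (div_mul_cancel₀ _ hd.ne')
  set c := -(1 - (q ^ N)⁻¹ * q ^ n) * (1 - q ^ (n + 1)) * (a * q - a * b * q ^ (n + 2)) /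
    ((1 - a * b * q ^ (n + 2) * q ^ n) * (1 - a * b * q ^ (n + 2) * q ^ (n + 1))) with hcdef
  have hc0 : 0 < c := by
    refine div_pos (mul_pos (mul_pos (by linarith) hq) ?_) hd
    have : a * q - a * b * q ^ (n + 2) = (a * q) * (1 - b * q * q ^ n) := by ring
    rw [this]
    exact mul_pos (mul_pos ha0 hq0) hb
  -- Substitute the connection formula into the Christoffel formula of degree `n + 1`, then apply
  -- that of degree `n` to `c (X - aq) Q_n(aq, b)`.
  refine ⟨a * q + e' + c, c * e, mul_pos hc0 he0, ?_⟩
  simp only [C_add, C_mul] at he he' ⊢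
  linear_combination -he' - (C c) * he - (X - C a * C q) * hc

/-- A q-Chu–Vandermonde evaluation. The Christoffel formula at `X = q^{-N}` expresses degree `n + 1`
through degree `n` at `a` and `aq`, so the induction runs over all `a`. -/
theorem qHahn_eval_inv_pow (ha0 : 0 < a) (ha1 : a * q < 1) (hb0 : 0 < b) (hb1 : b * q < 1)
    (hnN : n ≤ N) : (qHahn n a b N q).eval ((q ^ N)⁻¹) =
      (-a) ^ n * q ^ ((n + 1).choose 2) * qPoch ((q ^ N)⁻¹) q n * qPoch (b * q) q n /
        qPoch (a * b * q ^ (n + 1)) q n := by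
  induction n generalizing a with
  | zero => simp [qHahn_zero, qPoch_zero]
  | succ n ih =>
    have ha : ∀ j, 0 < 1 - a * q * q ^ j := one_sub_mul_pow_pos hq0 hq1 (mul_pos ha0 hq0) ha1
    rcases Nat.eq_zero_or_pos n with rfl | hn
    · have hs := one_sub_mul_mul_pow_pos hq0 hq1 ha0 ha1 hb0 hb1 le_rfl 0
      have ha' := ha 0
      rw [pow_zero, mul_one] at hs ha'
      rw [qHahn_one hq0 hq1 hnN ha'.ne' hs.ne']
      simp only [eval_sub, eval_X, eval_C, qPoch, Finset.prod_range_one, pow_zero, mul_one,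
        zero_add, Nat.choose_self, pow_one, one_add_one_eq_two]
      generalize (q ^ N)⁻¹ = r
      rw [eq_div_iff hs.ne', sub_mul, div_mul_cancel₀ _ hs.ne']
      ring
    · have hs := one_sub_mul_mul_pow_pos hq0 hq1 ha0 ha1 hb0 hb1 (by omega : 2 ≤ n + 1)
      have hs0 := (hs 0).ne'
      rw [pow_zero, mul_one] at hs0
      have hsn := (hs n).ne'
      have hsn1 := (hs (n + 1)).ne'
      have hP : qPoch (a * b * q ^ (n + 1)) q n ≠ 0 := qPoch_ne_zero fun j _ => (hs j).ne'
      have he := qHahn_christoffel hq0 hq1 hnN (fun j => (ha j).ne') (fun j => (hs j).ne') _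
        (div_mul_cancel₀ _ (mul_ne_zero hsn hsn1))
      have h := congrArg (eval ((q ^ N)⁻¹)) he
      rw [eval_add, eval_mul, eval_mul, eval_C, eval_sub, eval_X, eval_C,
        ih (mul_pos ha0 hq0) (by nlinarith [mul_pos ha0 hq0]) (by omega),
        ih ha0 ha1 (by omega), ← sub_eq_iff_eq_add] at h
      rw [← h, Nat.choose_succ_succ' (n + 1) 1, Nat.choose_one_right,
        show a * q * b * q ^ (n + 1) = a * b * q ^ (n + 1) * q by ring,
        show a * b * q ^ (n + 1 + 1) = a * b * q ^ (n + 1) * q by ring,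
        qPoch_succ (a * b * q ^ (n + 1) * q), qPoch_mul_eq_div hs0, qPoch_succ (b * q),
        qPoch_succ ((q ^ N)⁻¹), one_add_one_eq_two, neg_pow (a * q), neg_pow a, neg_pow a,
        mul_pow, pow_add q (n + 1)]
      clear h he ih hs ha
      generalize qPoch (a * b * q ^ (n + 1)) q n = S at *
      generalize qPoch (b * q) q n = B
      generalize qPoch ((q ^ N)⁻¹) q n = R
      generalize (q ^ N)⁻¹ = r
      generalize q ^ (n + 1).choose 2 = T
      simp only [pow_succ] at *
      generalize (-1 : ℝ) ^ n = ε
      generalize a ^ n = z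
      generalize q ^ n = x at *
      rw [show 1 - a * b * (x * q) * q * x = 1 - a * b * (x * q) * (x * q) by ring]
      generalize h1 : 1 - a * b * (x * q) = D1 at *
      generalize h2 : 1 - a * b * (x * q) * x = D2 at *
      generalize h3 : 1 - a * b * (x * q) * (x * q) = D3 at *
      field_simp
      subst h1 h2 h3
      ring

theorem qHahn_eval_one_sign (ha : ∀ j, 0 < 1 - a * q * q ^ j)
    (hs : ∀ j < n, 0 < 1 - a * b * q ^ (n + 1) * q ^ j) (hnN : n ≤ N) :
    0 < (-1) ^ n * (qHahn n a b N q).eval 1 := by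
  rw [qHahn_eval_one _ _ _ _ hq0.ne', mul_div_assoc', mul_left_comm]
  exact div_pos (mul_pos (qPoch_pos fun j _ => ha j)
    (neg_one_pow_mul_qPoch_pos fun j hj => one_sub_inv_pow_mul_neg hq0 hq1 (hj.trans_le hnN)))
    (qPoch_pos hs)

theorem qHahn_eval_inv_pow_pos (ha0 : 0 < a) (ha1 : a * q < 1) (hb0 : 0 < b) (hb1 : b * q < 1)
    (hnN : n ≤ N) : 0 < (qHahn n a b N q).eval ((q ^ N)⁻¹) := by
  have hs : ∀ j < n, 0 < 1 - a * b * q ^ (n + 1) * q ^ j := fun j hj =>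
    one_sub_mul_mul_pow_pos hq0 hq1 ha0 ha1 hb0 hb1 (by omega) j
  have hN : 0 < (-1) ^ n * qPoch ((q ^ N)⁻¹) q n :=
    neg_one_pow_mul_qPoch_pos fun j hj => one_sub_inv_pow_mul_neg hq0 hq1 (hj.trans_le hnN)
  rw [qHahn_eval_inv_pow hq0 hq1 ha0 ha1 hb0 hb1 hnN, neg_pow,
    show (-1) ^ n * a ^ n * q ^ ((n + 1).choose 2) * qPoch ((q ^ N)⁻¹) q n =
      a ^ n * q ^ ((n + 1).choose 2) * ((-1) ^ n * qPoch ((q ^ N)⁻¹) q n) by ring]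
  exact div_pos (mul_pos (mul_pos (mul_pos (pow_pos ha0 _) (pow_pos hq0 _)) hN)
    (qPoch_pos fun j _ => one_sub_mul_pow_pos hq0 hq1 (mul_pos hb0 hq0) hb1 j)) (qPoch_pos hs)

theorem exists_interlacedZeros_qHahn (ha0 : 0 < a) (ha1 : a * q < 1) (hb0 : 0 < b)
    (hb1 : b * q < 1) (hnN : n + 1 ≤ N) :
    ∃ x w, InterlacedZeros (qHahn (n + 1) a b N q) (qHahn n a b N q) n x w ∧
      ∀ j ∈ Finset.Icc 1 (n + 1), 1 < x j ∧ x j < (q ^ N)⁻¹ := by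
  refine exists_interlacedZeros_of_recurrence (P := fun k => qHahn k a b N q) (N := N)
    ?_ (fun k hk => qHahn_monic hq0 hq1 ha0 ha1 hb0 hb1 hk) (fun k hk => ?_)
    (fun k hk => qHahn_eval_inv_pow_pos hq0 hq1 ha0 ha1 hb0 hb1 hk)
    (fun k hk => exists_qHahn_recurrence hq0 hq1 ha0 ha1 hb0 hb1 hk) n hnN
  · have := one_sub_inv_pow_mul_neg hq0 hq1 (by omega : 0 < N)
    rw [pow_zero, mul_one] at this
    linarith
  · exact qHahn_eval_one_sign hq0 hq1 (one_sub_mul_pow_pos hq0 hq1 (mul_pos ha0 hq0) ha1)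
      (fun j hj => one_sub_mul_mul_pow_pos hq0 hq1 ha0 ha1 hb0 hb1 (by omega) j) hk

/-- The shift `α ↦ α / q`, with `a = α / q`. -/
theorem exists_qHahn_shift_left (hb0 : 0 < b) (hb1 : b * q < 1) (ha1 : 1 < a * q)
    (ha2 : a * q * q < 1) (hs : ∀ j, 0 < 1 - a * b * q ^ (n + 2) * q ^ j) (hnN : n + 1 ≤ N) :
    ∃ c, 0 < c ∧
      qHahn (n + 1) a b N q = qHahn (n + 1) (a * q) b N q + C c * qHahn n (a * q) b N q ∧
      0 < (-1) ^ n * (qHahn (n + 1) a b N q).eval 1 := by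
  have hb := one_sub_mul_pow_pos hq0 hq1 (mul_pos hb0 hq0) hb1 n
  have ha : ∀ j, 0 < 1 - a * q * q * q ^ j :=
    one_sub_mul_pow_pos hq0 hq1 (by nlinarith) ha2
  have ha' : ∀ j, 1 - a * q * q ^ j ≠ 0 := by
    rintro (_ | j)
    · rw [pow_zero, mul_one]; exact (by linarith : 1 - a * q < 0).ne
    · rw [pow_succ', ← mul_assoc]; exact (ha j).ne'
  have hr := one_sub_inv_pow_mul_neg hq0 hq1 (by omega : n < N)
  have hq := one_sub_pow_succ_pos hq0 hq1 n
  rw [← pow_succ'] at hq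
  have hd := mul_pos (hs n) (hs (n + 1))
  refine ⟨_, ?_, qHahn_connection_left hq0 hq1 hnN ha' (fun j => (hs j).ne') _
    (div_mul_cancel₀ _ hd.ne'), ?_⟩
  · refine div_pos (mul_pos (mul_pos (by linarith) hq) ?_) hd
    rw [show a * q - a * b * q ^ (n + 2) = (a * q) * (1 - b * q * q ^ n) by ring]
    exact mul_pos (by linarith) hb
  · have hN : 0 < (-1) ^ (n + 1) * qPoch ((q ^ N)⁻¹) q (n + 1) :=
      neg_one_pow_mul_qPoch_pos fun j hj => one_sub_inv_pow_mul_neg hq0 hq1 (hj.trans_le hnN)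
    rw [qHahn_eval_one _ _ _ _ hq0.ne', qPoch_succ' (a * q), mul_div_assoc',
      -- The single factor `1 - aq` is negative and absorbs one sign, turning `(-1)^n` into
      -- `(-1)^(n+1)`.
      show (-1) ^ n * ((1 - a * q) * qPoch (a * q * q) q n * qPoch ((q ^ N)⁻¹) q (n + 1)) =
        (a * q - 1) * qPoch (a * q * q) q n *
          ((-1) ^ (n + 1) * qPoch ((q ^ N)⁻¹) q (n + 1)) by ring]
    exact div_pos (mul_pos (mul_pos (by linarith) (qPoch_pos fun j _ => ha j)) hN)
      (qPoch_pos fun j _ => hs j)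

/-- The shift `β ↦ β / q`, with `b = β / q`. -/
theorem exists_qHahn_shift_right (ha0 : 0 < a) (ha1 : a * q < 1) (hb1 : 1 < b * q)
    (hb2 : b * q * q < 1) (hs : ∀ j, 0 < 1 - a * b * q ^ (n + 2) * q ^ j) (hnN : n + 1 ≤ N) :
    ∃ d < 0, qHahn (n + 1) a b N q = qHahn (n + 1) a (b * q) N q + C d * qHahn n a (b * q) N q ∧
      (qHahn (n + 1) a b N q).eval ((q ^ N)⁻¹) < 0 := by
  have hb0 : 0 < b * q := by linarith
  have ha : ∀ j, 0 < 1 - a * q * q ^ j := one_sub_mul_pow_pos hq0 hq1 (mul_pos ha0 hq0) ha1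
  have hr := one_sub_inv_pow_mul_neg hq0 hq1 (by omega : n < N)
  have hq := one_sub_pow_succ_pos hq0 hq1 n
  rw [← pow_succ'] at hq
  have hd := mul_pos (hs n) (hs (n + 1))
  have hab : 0 < a * b * q ^ (n + 2) := by
    rw [show a * b * q ^ (n + 2) = a * (b * q) * q ^ (n + 1) by ring]
    exact mul_pos (mul_pos ha0 hb0) (pow_pos hq0 _)
  have hrel := qHahn_connection_right hq0 hq1 hnN (fun j => (ha j).ne') (fun j => (hs j).ne') _
    (div_mul_cancel₀ _ hd.ne')
  refine ⟨_, ?_, hrel, ?_⟩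
  · refine div_neg_of_neg_of_pos ?_ hd
    exact mul_neg_of_neg_of_pos (mul_neg_of_neg_of_pos (mul_neg_of_neg_of_pos hr hq) (ha n)) hab
  · have hV := qHahn_eval_inv_pow_pos hq0 hq1 ha0 ha1 hb0 hb2 (by omega : n ≤ N)
    -- `qHahn_eval_inv_pow` needs `b * q < 1`, which fails here, so it is applied at `b * q` and
    -- carried over by the connection formula.
    have h1 : (qHahn (n + 1) a b N q).eval ((q ^ N)⁻¹) =
        a * q ^ (n + 1) * (1 - (q ^ N)⁻¹ * q ^ n) * (b * q - 1) /
          (1 - a * b * q ^ (n + 2) * q ^ n) * (qHahn n a (b * q) N q).eval ((q ^ N)⁻¹) := by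
      have hs0 := (hs 0).ne'
      rw [pow_zero, mul_one] at hs0
      have hsn := (hs n).ne'
      have hsn1 := (hs (n + 1)).ne'
      have hP : qPoch (a * b * q ^ (n + 2)) q n ≠ 0 := qPoch_ne_zero fun j _ => (hs j).ne'
      rw [hrel, eval_add, eval_mul, eval_C, qHahn_eval_inv_pow hq0 hq1 ha0 ha1 hb0 hb2 hnN,
        qHahn_eval_inv_pow hq0 hq1 ha0 ha1 hb0 hb2 (by omega : n ≤ N),
        Nat.choose_succ_succ' (n + 1) 1, Nat.choose_one_right,
        show a * (b * q) * q ^ (n + 1) = a * b * q ^ (n + 2) by ring,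
        show a * (b * q) * q ^ (n + 1 + 1) = a * b * q ^ (n + 2) * q by ring,
        qPoch_mul_eq_div hs0, qPoch_succ (a * b * q ^ (n + 2)), qPoch_succ (b * q * q),
        qPoch_succ ((q ^ N)⁻¹), one_add_one_eq_two, neg_pow a, neg_pow a, pow_add q (n + 1)]
      clear hrel hV hs ha hd hab
      generalize qPoch (a * b * q ^ (n + 2)) q n = S at *
      generalize qPoch (b * q * q) q n = B
      generalize qPoch ((q ^ N)⁻¹) q n = R
      generalize (q ^ N)⁻¹ = r at *
      generalize q ^ (n + 1).choose 2 = T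
      simp only [pow_succ] at *
      generalize (-1 : ℝ) ^ n = ε
      generalize a ^ n = z
      generalize q ^ n = x at *
      generalize h1 : 1 - a * b * (x * q * q) = D1 at *
      generalize h2 : 1 - a * b * (x * q * q) * x = D2 at *
      generalize h3 : 1 - a * b * (x * q * q) * (x * q) = D3 at *
      field_simp
      subst h1 h2 h3
      ring
    rw [h1]
    refine mul_neg_of_neg_of_pos (div_neg_of_neg_of_pos ?_ (hs n)) hV
    exact mul_neg_of_neg_of_pos (mul_neg_of_pos_of_neg (mul_pos ha0 (pow_pos hq0 _)) hr)
      (by linarith)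

end Parameters

/-! ### The main theorem. -/

theorem monic_add_C_mul {P Q : ℝ[X]} {n : ℕ} (hP : P.Monic ∧ P.natDegree = n + 1)
    (hQ : Q.natDegree = n) (c : ℝ) : (P + C c * Q).Monic ∧ (P + C c * Q).natDegree = n + 1 := by
  have h : (C c * Q).natDegree < P.natDegree :=
    (natDegree_C_mul_le c Q).trans_lt (by omega)
  exact ⟨hP.1.add_of_left (degree_lt_degree h),
    by rw [natDegree_add_eq_left_of_natDegree_lt h, hP.2]⟩

theorem theorem2p7 (q : ℝ) (hq0 : 0 < q) (hq1 : q < 1) (N n : ℕ) (hn1 : 1 ≤ n) (hnN : n ≤ N)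
    (α β : ℝ) (hα0 : 0 < α * q) (hα1 : α * q < 1) (hβ0 : 0 < β * q) (hβ1 : β * q < 1)
    (hn : n = 1 → α * β * q < 1) :
    ∃ x w : ℕ → ℝ,
      IsOrderedZeros (qHahn n α β N q) n x ∧
      IsOrderedZeros (qHahn (n - 1) α β N q) (n - 1) w ∧
      (1 < α → ∃ y : ℕ → ℝ, IsOrderedZeros (qHahn n (α / q) β N q) n y ∧
        y 1 < 1 ∧ 1 < x 1 ∧
        (∀ j ∈ Finset.Icc 1 n, y j < x j) ∧
        (∀ j ∈ Finset.Icc 1 (n - 1), x j < w j ∧ w j < y (j + 1)) ∧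
        x n < q ^ (-(N : ℤ))) ∧
      (1 < β → ∃ z : ℕ → ℝ, IsOrderedZeros (qHahn n α (β / q) N q) n z ∧
        1 < x 1 ∧
        (∀ j ∈ Finset.Icc 1 n, x j < z j) ∧
        (∀ j ∈ Finset.Icc 1 (n - 1), z j < w j ∧ w j < x (j + 1)) ∧
        x n < q ^ (-(N : ℤ)) ∧ q ^ (-(N : ℤ)) < z n) := by
  obtain ⟨m, rfl⟩ : ∃ m, n = m + 1 := ⟨n - 1, by omega⟩
  simp only [Nat.add_sub_cancel, zpow_neg, zpow_natCast]
  have ha0 : 0 < α := pos_of_mul_pos_left hα0 hq0.le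
  have hb0 : 0 < β := pos_of_mul_pos_left hβ0 hq0.le
  obtain ⟨x, w, h, hx⟩ := exists_interlacedZeros_qHahn hq0 hq1 ha0 hα1 hb0 hβ1 hnN
  have hP := qHahn_monic hq0 hq1 ha0 hα1 hb0 hβ1 hnN
  have hQ := (qHahn_monic hq0 hq1 ha0 hα1 hb0 hβ1 (by omega : m ≤ N)).2
  have hx1 := (hx 1 (by simp)).1
  have hxn := (hx (m + 1) (by simp)).2
  -- These are the denominators after either shift, which costs one power of `q`. In degree one they
  -- involve `αβq`, hence the extra hypothesis `hn`.
  have hs : ∀ j, 0 < 1 - α * β * q ^ (m + 1) * q ^ j := by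
    intro j
    rcases Nat.eq_zero_or_pos m with rfl | hm
    · rw [zero_add, pow_one]
      exact one_sub_mul_pow_pos hq0 hq1 (mul_pos (mul_pos ha0 hb0) hq0) (hn rfl) j
    · exact one_sub_mul_mul_pow_pos hq0 hq1 ha0 hα1 hb0 hβ1 (by omega) j
  refine ⟨x, w, h.zeros_left, h.zeros_right, fun hα => ?_, fun hβ => ?_⟩
  · have hαq : α / q * q = α := div_mul_cancel₀ _ hq0.ne'
    have hs' : ∀ j, 0 < 1 - α / q * β * q ^ (m + 2) * q ^ j := fun j => by
      rw [show α / q * β * q ^ (m + 2) = (α / q * q) * β * q ^ (m + 1) by ring, hαq]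
      exact hs j
    obtain ⟨c, hc, hrel, h1⟩ := exists_qHahn_shift_left hq0 hq1 hb0 hβ1 (by rwa [hαq])
      (by rwa [hαq]) hs' hnN
    rw [hαq] at hrel
    have hp := monic_add_C_mul hP hQ c
    rw [← hrel] at hp
    obtain ⟨y, hy, hy1, hyx, hwy⟩ := h.exists_zeros_add hp.1 hp.2 hc hrel hx1 h1
    exact ⟨y, hy, hy1, hx1, hyx, fun j hj => ⟨h.left_lt j hj, hwy j hj⟩, hxn⟩
  · have hβq : β / q * q = β := div_mul_cancel₀ _ hq0.ne'
    have hs' : ∀ j, 0 < 1 - α * (β / q) * q ^ (m + 2) * q ^ j := fun j => by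
      rw [show α * (β / q) * q ^ (m + 2) = α * (β / q * q) * q ^ (m + 1) by ring, hβq]
      exact hs j
    obtain ⟨d, hd, hrel, h1⟩ := exists_qHahn_shift_right hq0 hq1 ha0 hα1 (by rwa [hβq])
      (by rwa [hβq]) hs' hnN
    rw [hβq] at hrel
    have hp := monic_add_C_mul hP hQ d
    rw [← hrel] at hp
    obtain ⟨z, hz, hz1, hxz, hzw⟩ := h.exists_zeros_sub hp.1 hp.2 hd hrel hxn h1
    exact ⟨z, hz, hx1, hxz, fun j hj => ⟨hzw j hj, h.lt_succ j hj⟩, hxn, hz1⟩
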